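/- **Setting.** A stage game $\Gamma$ has a finite player set $N$, action sets $\{0,1\}$ and payoffs $u_i$; a profile is identified with the set of players who choose $1$, so $u_i(Y)$ is $i$'s payoff when exactly the players in $Y\subseteq N$ choose $1$. For $i\in N$ and $A\subseteq N\setminus i$ put $u_i^*(A)=\max\{u_i(A),u_i(A\cup i)\}$. Assume that for all $i\in N$ and $A\subsetneq B\subseteq N\setminus i$: * (single crossing) $u_i(A\cup i)\ge u_i(A)\Rightarrow u_i(B\cup i)\ge u_i(B)$, and the same with both inequalities strict; * (common interests) $u_i^*(A)\le u_i^*(B)$, with strict inequality if $u_i^*(B)=u_i(B\cup i)$ and $u_i^*(A)=u_i(A)$; * (deviation-proofness) $u_i(B\cup i)\ge u_i(A)\Rightarrow u_i(B\cup i)\ge u_i(B)$, and the same with both inequalities strict; and that $u_i(N)>u_i(N\setminus i)$ for all $i\in N$. In the synchronous game $\Gamma(T)$, $T\ge 1$, all players simultaneously choose an action at each stage $t=1,\dots,T$ after observing all past actions; a player who has chosen $1$ must choose $1$ at all later stages; payoffs are those of $\Gamma$ at the profile of stage $T$. An MSPNE is a pure-strategy subgame perfect Nash equilibrium in which each player's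 action at any stage is non-decreasing in the history (componentwise order). For $X\subseteq N$, $\tau_\Gamma(X)$ is the least $T\ge1$ such that all players in $X$ choose $1$ at the last stage in every MSPNE of $\Gamma(T)$, and $\tau(\Gamma)=\tau_\Gamma(N)$. For $X\subseteq N$, $\underline\Gamma(X)$ and $\overline\Gamma(X)$ are the stage games with player set $X$ and payoffs $Y\mapsto u_i(Y)$ and $Y\mapsto u_i(Y\cup(N\setminus X))$ respectively. $SSS(\Gamma)$ is the family of non-empty $X\subseteq N$ with $u_i(X)>u_i(X\setminus i)$ for all $i\in X$ (strictly sufficient sets), and $SSE(\Gamma)$ is the family of those $X\in SSS(\Gamma)$ that are Nash equilibria of $\Gamma$. **Theorem.** $\tau_\Gamma(X)$ is well defined (finite) for all $X\subseteq N$, $\tau_\Gamma(\emptyset)=1$, and: 1. For every non-empty $X\subseteq N$, $$\tau_\Gamma(X)=\min_{Y\in SSS(\Gamma),\,Y\supseteq X}\tau(\underline\Gamma(Y)).$$ 2. If $i\in N$ satisfies $u_i(\{i\})>u_i(\emptyset)$, then $\tau(\Gamma)=\tau(\overline\Gamma(N\setminus i))$. If $N=\emptyset$, then $\tau(\Gamma)=1$.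 If $N\neq\emptyset$ and $u_i(\{i\})\le u_i(\emptyset)$ for all $i\in N$, then $$\tau(\Gamma)=\min\Big\{1+\min_{i\in N}\tau(\overline\Gamma(N\setminus i)),\ \min_{X\in SSS(\Gamma)\setminus\{\emptyset,N\}}\max\{\tau(\underline\Gamma(X)),\tau(\overline\Gamma(N\setminus X))\}\Big\},$$ where a minimum over the empty family is $+\infty$. Both 1 and 2 remain true with $SSE(\Gamma)$ in place of $SSS(\Gamma)$. -/

import Mathlib

/-- A binary-action stage game. The player set `players` is a finite set of labels from `ι`.
An action profile is identified with the set of players who choose action `1`, so `u i Y` is the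
payoff of player `i` when exactly the players in `Y` choose `1`; only `i ∈ players` and
`Y ⊆ players` matter. -/
structure StageGame (ι : Type*) where
  players : Finset ι
  u : ι → Finset ι → ℝ

namespace StageGame

variable {ι : Type*} [DecidableEq ι] (Γ : StageGame ι)

/-- `u_i^*(a_{-i})`: the payoff of `i` from a best action when the other players who choose `1`
are those in `A` (with `i ∉ A`). -/
noncomputable def bestPayoff (i : ι) (A : Finset ι) : ℝ :=
  max (Γ.u i A) (Γ.u i (insert i A))

/-- Single crossing. The profiles `a_{-i} < a'_{-i}` are the sets `A ⊂ B` not containing `i`. -/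
def SingleCrossing : Prop :=
  ∀ i ∈ Γ.players, ∀ A B : Finset ι, B ⊆ Γ.players.erase i → A ⊂ B →
    (Γ.u i A ≤ Γ.u i (insert i A) → Γ.u i B ≤ Γ.u i (insert i B)) ∧
    (Γ.u i A < Γ.u i (insert i A) → Γ.u i B < Γ.u i (insert i B))

/-- Common interests, with the tie-break rule: if action `1` is a best action against `B` and
action `0` is a best action against the smaller `A`, then the best payoff is strictly larger
against `B`. -/
def CommonInterests : Prop :=
  ∀ i ∈ Γ.players, ∀ A B : Finset ι, B ⊆ Γ.players.erase i → A ⊂ B →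
    Γ.bestPayoff i A ≤ Γ.bestPayoff i B ∧
    (Γ.bestPayoff i B = Γ.u i (insert i B) → Γ.bestPayoff i A = Γ.u i A →
      Γ.bestPayoff i A < Γ.bestPayoff i B)

/-- The deviation-proof condition. -/
def DeviationProof : Prop :=
  ∀ i ∈ Γ.players, ∀ A B : Finset ι, B ⊆ Γ.players.erase i → A ⊂ B →
    (Γ.u i A ≤ Γ.u i (insert i B) → Γ.u i B ≤ Γ.u i (insert i B)) ∧
    (Γ.u i A < Γ.u i (insert i B) → Γ.u i B < Γ.u i (insert i B))

/-- Pure strategy Nash equilibria of the stage game. -/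
def IsNash (X : Finset ι) : Prop :=
  X ⊆ Γ.players ∧
    ∀ i ∈ Γ.players, Γ.u i (insert i X) ≤ Γ.u i X ∧ Γ.u i (X.erase i) ≤ Γ.u i X

/-- Strictly sufficient sets (by convention non-empty). -/
def SSS : Set (Finset ι) :=
  {X | X ⊆ Γ.players ∧ X.Nonempty ∧ ∀ i ∈ X, Γ.u i (X.erase i) < Γ.u i X}

/-- Strictly sufficient equilibria. -/
def SSE : Set (Finset ι) :=
  {X | X ∈ Γ.SSS ∧ Γ.IsNash X}

/-- The auxiliary game among the players in `X`, all other players choosing `1`. -/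
def upper (X : Finset ι) : StageGame ι where
  players := X
  u := fun i Y => Γ.u i (Y ∪ (Γ.players \ X))

/-- The auxiliary game among the players in `X`, all other players choosing `0`. -/
def lower (X : Finset ι) : StageGame ι where
  players := X
  u := Γ.u

/-! ### The synchronous game with `T` stages

A history is the list of the profiles played so far, most recent first; the empty list is the
initial history, and a history of length `k` precedes stage `k + 1`. -/

/-- Histories consist of profiles of players and respect irreversibility: whoever has chosen `1`
keeps choosing `1`. -/
def IsHistory (h : List (Finset ι)) : Prop :=
  (∀ a ∈ h, a ⊆ Γ.players) ∧ h.Pairwise (fun later earlier => earlier ⊆ later)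

/-- `σ` is a pure strategy of player `i` in the `T`-stage game: at every history before the end it
prescribes an action (`true` is `1`), and it prescribes `1` if `i` has already chosen `1`.
Values of `σ` elsewhere are irrelevant. -/
def IsStrategy (T : ℕ) (i : ι) (σ : List (Finset ι) → Bool) : Prop :=
  ∀ h, Γ.IsHistory h → h.length < T → i ∈ h.headD ∅ → σ h = true

/-- The profile played at history `h` under the strategy profile `s`. -/
def stageProfile (s : ι → List (Finset ι) → Bool) (h : List (Finset ι)) : Finset ι :=
  Γ.players.filter (fun i => s i h = true)

/-- The history reached from `h` after `n` further stages of play according to `s`. -/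
def play (s : ι → List (Finset ι) → Bool) : ℕ → List (Finset ι) → List (Finset ι)
  | 0, h => h
  | n + 1, h => play s n (Γ.stageProfile s h :: h)

/-- The profile of the last stage `T` when play starts at history `h` and follows `s`. -/
def outcome (T : ℕ) (s : ι → List (Finset ι) → Bool) (h : List (Finset ι)) : Finset ι :=
  (Γ.play s (T - h.length) h).headD ∅

/-- Pure strategy subgame perfect Nash equilibria of the `T`-stage game: at every history before
the end, no player gains by switching to another strategy. -/
def IsSPNE (T : ℕ) (s : ι → List (Finset ι) → Bool) : Prop :=
  (∀ i ∈ Γ.players, Γ.IsStrategy T i (s i)) ∧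
  ∀ h, Γ.IsHistory h → h.length < T → ∀ i ∈ Γ.players, ∀ σ, Γ.IsStrategy T i σ →
    Γ.u i (Γ.outcome T (Function.update s i σ) h) ≤ Γ.u i (Γ.outcome T s h)

/-- Monotonicity in history: at a (componentwise) higher history of the same length every player
chooses a higher action. -/
def IsMonotone (T : ℕ) (s : ι → List (Finset ι) → Bool) : Prop :=
  ∀ i ∈ Γ.players, ∀ h₁ h₂, Γ.IsHistory h₁ → Γ.IsHistory h₂ → h₁.length < T →
    List.Forall₂ (· ⊆ ·) h₂ h₁ → s i h₂ ≤ s i h₁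

/-- `O(Γ(T))`: the outcomes of the monotone subgame perfect Nash equilibria (MSPNE). -/
def mspneOutcomes (T : ℕ) : Set (Finset ι) :=
  {Y | ∃ s, Γ.IsSPNE T s ∧ Γ.IsMonotone T s ∧ Y = Γ.outcome T s []}

/-- `τ_Γ(X)`: the least number `T ≥ 1` of stages such that all players in `X` choose `1` in all
MSPNE of the `T`-stage game (`⊤` if there is no such `T`). -/
noncomputable def tauOf (X : Finset ι) : ℕ∞ :=
  ⨅ (T : ℕ) (_ : 1 ≤ T ∧ ∀ Y ∈ Γ.mspneOutcomes T, X ⊆ Y), (T : ℕ∞)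

/-- `τ(Γ) = τ_Γ(N)`. -/
noncomputable def tau : ℕ∞ := Γ.tauOf Γ.players

/-- The value of the recursion when the game may be divided along a proper set from the
family `S`: the minimum of `1 + min_i τ(Γ̄(N ∖ i))` and
`min_X max {τ(Γ̲(X)), τ(Γ̄(N ∖ X))}`, `X` ranging over `S ∖ {∅, N}`. A minimum over the empty family
is `⊤`. -/
noncomputable def recursionValue (S : Set (Finset ι)) : ℕ∞ :=
  min (1 + ⨅ i ∈ Γ.players, (Γ.upper (Γ.players.erase i)).tau)
    (⨅ X ∈ S \ {∅, Γ.players}, max (Γ.lower X).tau (Γ.upper (Γ.players \ X)).tau)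

end StageGame

/-!
The proof describes the least outcome of a monotone subgame perfect equilibrium in closed form.

Say that `C` *forces* `Y` within `T` stages when this can be derived from three rules: `Y` forces
`Y`; if `insert i C` forces `Y` within `T` stages and action `1` is strictly optimal for `i` at
`Y`, then `C` forces `Y` within `T + 1` stages (player `i` takes the lead); and forcing within `T`
stages is transitive. Single crossing makes the relation monotone in `C`
(`Forces.union_right`), so there is a largest set `Γ.forced T C` which `C` forces within `T` stages,
and it is a closure operator.

* Every equilibrium outcome contains `Γ.forced T ∅` (`Forces.subset_outcome`). Indeed, if `i` is
  absent from the outcome `O` but taking the lead would produce `O'`, where action `1` is strictly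
  optimal for `i`, then by common interests with the tie-break rule `i` strictly prefers `O'`.
  The induction is on derivations, for the statement "if the outcome contains `C` then it contains
  `Y`", which makes the transitivity rule trivial.
* Conversely, "play `1` if and only if you belong to the set forced by those already committed" is a
  monotone subgame perfect equilibrium with outcome `Γ.forced T ∅`
  (`isSPNE_forcedStrategy`). Deviations are excluded one stage at a time: a player in
  the forced set strictly prefers to be there, and for a player outside it deviation-proofness
  turns a profitable lead into an application of the lead rule.

Hence, for `T ≥ 1`, `τ_Γ(X) ≤ T` means `X ⊆ Γ.forced T ∅` (`tauOf_le_iff`). The forcing relations of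
`Γ.lower X` and `Γ.upper X` are restrictions of that of `Γ`, so the first formula says that the sets
forced by `∅` are strictly sufficient, and the recursion is the inversion of the rules
(`Forces.lead_or_split`). To split along a strictly sufficient *equilibrium*, take a smallest
nonempty proper set `X` forced by `∅` and enlarge it to `Γ.forced 1 X`, which is an equilibrium. By
minimality `X` is forced through a leader; if the enlargement is all of `N`, then so is `N`.
-/

namespace StageGame

variable {ι : Type*} [DecidableEq ι]

/-! ### The forcing relation -/

/-- `Forces u T C Y`: once the players in `C` have chosen `1`, the players in `Y` are bound to
choose `1` within `T` further stages, for the payoffs `u`. In the rule `lead`, player `i` chooses `1`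
at the first of `T + 1` stages because this makes all of `Y` follow. The player set does not occur;
it only bounds the sets `Y` that are considered. -/
inductive Forces (u : ι → Finset ι → ℝ) : ℕ → Finset ι → Finset ι → Prop
  | refl (T : ℕ) (Y : Finset ι) : Forces u T Y Y
  | lead {T : ℕ} {C Y : Finset ι} {i : ι} (hi : i ∉ C) (hu : u i (Y.erase i) < u i Y)
      (h : Forces u T (insert i C) Y) : Forces u (T + 1) C Y
  | trans {T : ℕ} {C X Y : Finset ι} (h₁ : Forces u T C X) (h₂ : Forces u T X Y) : Forces u T C Y

namespace Forces

variable {u : ι → Finset ι → ℝ} {T : ℕ} {C Y : Finset ι}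

theorem subset (h : Forces u T C Y) : C ⊆ Y := by
  induction h with
  | refl => exact subset_rfl
  | lead _ _ _ ih => exact (Finset.subset_insert _ _).trans ih
  | trans _ _ ih₁ ih₂ => exact ih₁.trans ih₂

theorem succ (h : Forces u T C Y) : Forces u (T + 1) C Y := by
  induction h with
  | refl => exact refl _ _
  | lead hi hu _ ih => exact lead hi hu ih
  | trans _ _ ih₁ ih₂ => exact trans ih₁ ih₂

theorem mono {T' : ℕ} (hT : T ≤ T') (h : Forces u T C Y) : Forces u T' C Y := by
  induction hT with
  | refl => exact h
  | step _ ih => exact ih.succ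

theorem eq_of_zero (h : Forces u 0 C Y) : C = Y := by
  generalize hT : 0 = T at h
  induction h with
  | refl => rfl
  | lead => omega
  | trans _ _ ih₁ ih₂ => exact (ih₁ hT).trans (ih₂ hT)

/-- A player who strictly prefers to join `C` does so within any positive number of stages. -/
theorem insert_of_lt {i : ι} (hT : 1 ≤ T) (hi : i ∉ C) (hu : u i C < u i (insert i C)) :
    Forces u T C (insert i C) :=
  mono hT (lead hi (by rwa [Finset.erase_insert hi]) (refl 0 _))

/-- Inversion: a nontrivial instance of forcing either starts with a lead or splits along a set
strictly in between. -/
theorem lead_or_split (h : Forces u T C Y) (hne : C ≠ Y) :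
    (∃ i T', i ∉ C ∧ T = T' + 1 ∧ Forces u T' (insert i C) Y) ∨
      ∃ X, X ≠ C ∧ X ≠ Y ∧ Forces u T C X ∧ Forces u T X Y := by
  induction h with
  | refl => exact absurd rfl hne
  | lead hi _ h _ => exact Or.inl ⟨_, _, hi, rfl, h⟩
  | @trans T C X Y h₁ h₂ ih₁ ih₂ =>
    by_cases hC : X = C
    · subst hC; exact ih₂ hne
    by_cases hY : X = Y
    · subst hY; exact ih₁ hne
    exact Or.inr ⟨X, hC, hY, h₁, h₂⟩

/-- With `|Y ∖ C|` stages, the players in `Y ∖ C` can take the lead one after the other. -/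
theorem of_forall_lt (Y : Finset ι) :
    ∀ (n : ℕ) (C : Finset ι), C ⊆ Y → (Y \ C).card ≤ n →
      (∀ i ∈ Y, u i (Y.erase i) < u i Y) → Forces u n C Y := by
  intro n
  induction n with
  | zero =>
    intro C hC hn _
    have : Y ⊆ C := by simpa [Finset.sdiff_eq_empty_iff_subset] using hn
    rw [hC.antisymm this]
    exact refl _ _
  | succ n ih =>
    intro C hC hn hu
    by_cases hY : Y ⊆ C
    · rw [hC.antisymm hY]; exact refl _ _
    obtain ⟨i, hiY, hiC⟩ := Finset.not_subset.1 hY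
    refine lead hiC (hu i hiY) (ih _ (Finset.insert_subset hiY hC) ?_ hu)
    have hmem : i ∈ Y \ C := Finset.mem_sdiff.2 ⟨hiY, hiC⟩
    rw [Finset.sdiff_insert, Finset.card_erase_of_mem hmem]
    omega

/-! ### Forcing when some players are committed from the outset -/

/-- Forcing in the game where the players in `K` are fixed at `1` gives forcing in the full game. -/
theorem of_committed {K : Finset ι} (h : Forces (fun i Z => u i (Z ∪ K)) T C Y)
    (hd : Disjoint Y K) : Forces u T (C ∪ K) (Y ∪ K) := by
  induction h with
  | refl => exact refl _ _
  | @lead T C Y i hi hu h ih =>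
    have hiK : i ∉ K := Finset.disjoint_left.1 hd (h.subset (Finset.mem_insert_self _ _))
    refine lead (i := i) (by simp [hi, hiK]) ?_ ?_
    · rwa [Finset.erase_union_distrib, Finset.erase_eq_of_notMem hiK]
    · rw [← Finset.insert_union]; exact ih hd
  | trans _ h₂ ih₁ ih₂ => exact trans (ih₁ (hd.mono_left h₂.subset)) (ih₂ hd)

/-- Converse of `Forces.of_committed`: the forcing relation of the full game, started from a set
containing `K`, is that of the game where `K` is fixed at `1`. -/
theorem to_committed {K : Finset ι} (h : Forces u T C Y) (hK : K ⊆ C) :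
    Forces (fun i Z => u i (Z ∪ K)) T (C \ K) (Y \ K) := by
  induction h with
  | refl => exact refl _ _
  | @lead T C Y i hi hu h ih =>
    have hiK : i ∉ K := fun h => hi (hK h)
    have hKY : K ⊆ Y := hK.trans ((Finset.subset_insert _ _).trans h.subset)
    refine lead (i := i) (by simp [hi]) ?_ ?_
    · have h₁ : (Y \ K).erase i ∪ K = Y.erase i := by
        rw [← Finset.erase_eq_of_notMem hiK, ← Finset.erase_union_distrib,
          Finset.erase_eq_of_notMem hiK, Finset.sdiff_union_of_subset hKY]
      simpa only [h₁, Finset.sdiff_union_of_subset hKY] using hu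
    · rw [← Finset.insert_sdiff_of_notMem _ hiK]
      exact ih (hK.trans (Finset.subset_insert _ _))
  | trans h₁ _ ih₁ ih₂ => exact trans (ih₁ hK) (ih₂ (hK.trans h₁.subset))

end Forces

/-! ### Regular games -/

/-- The conditions on a stage game under which the least equilibrium outcome is described by the
forcing relation. -/
structure IsRegular (Γ : StageGame ι) : Prop where
  singleCrossing : Γ.SingleCrossing
  commonInterests : Γ.CommonInterests
  deviationProof : Γ.DeviationProof

variable {Γ : StageGame ι}

namespace IsRegular

theorem lower (hΓ : Γ.IsRegular) {X : Finset ι} (hX : X ⊆ Γ.players) : (Γ.lower X).IsRegular where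
  singleCrossing i hi A B hB hAB :=
    hΓ.singleCrossing i (hX hi) A B (hB.trans (Finset.erase_subset_erase i hX)) hAB
  commonInterests i hi A B hB hAB :=
    hΓ.commonInterests i (hX hi) A B (hB.trans (Finset.erase_subset_erase i hX)) hAB
  deviationProof i hi A B hB hAB :=
    hΓ.deviationProof i (hX hi) A B (hB.trans (Finset.erase_subset_erase i hX)) hAB

theorem upper (hΓ : Γ.IsRegular) {X : Finset ι} (hX : X ⊆ Γ.players) : (Γ.upper X).IsRegular := by
  have key : ∀ i ∈ X, ∀ A B : Finset ι, B ⊆ X.erase i → A ⊂ B →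
      B ∪ Γ.players \ X ⊆ Γ.players.erase i ∧ A ∪ Γ.players \ X ⊂ B ∪ Γ.players \ X := by
    intro i hi A B hB hAB
    have hBX : ∀ j ∈ B, j ≠ i ∧ j ∈ X := fun j hj => by simpa using hB hj
    refine ⟨fun j hj => ?_, ?_⟩
    · rcases Finset.mem_union.1 hj with hj | hj
      · exact Finset.mem_erase.2 ⟨(hBX j hj).1, hX (hBX j hj).2⟩
      · rw [Finset.mem_sdiff] at hj
        exact Finset.mem_erase.2 ⟨fun h => hj.2 (h ▸ hi), hj.1⟩
    · obtain ⟨j, hjB, hjA⟩ := Finset.exists_of_ssubset hAB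
      refine (Finset.ssubset_iff_of_subset (Finset.union_subset_union_left hAB.subset)).2
        ⟨j, Finset.mem_union_left _ hjB, ?_⟩
      simp [hjA, (hBX j hjB).2]
  refine ⟨fun i hi A B hB hAB => ?_, fun i hi A B hB hAB => ?_, fun i hi A B hB hAB => ?_⟩
  · obtain ⟨h₁, h₂⟩ := key i hi A B hB hAB
    simpa only [StageGame.upper, Finset.insert_union] using
      hΓ.singleCrossing i (hX hi) _ _ h₁ h₂
  · obtain ⟨h₁, h₂⟩ := key i hi A B hB hAB
    simpa only [StageGame.upper, bestPayoff, Finset.insert_union] using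
      hΓ.commonInterests i (hX hi) _ _ h₁ h₂
  · obtain ⟨h₁, h₂⟩ := key i hi A B hB hAB
    simpa only [StageGame.upper, Finset.insert_union] using
      hΓ.deviationProof i (hX hi) _ _ h₁ h₂

/-- Strict optimality of action `1` is inherited by larger profiles. -/
theorem lt_of_subset (hΓ : Γ.IsRegular) {i : ι} {Y Z : Finset ι} (hi : i ∈ Y) (hYZ : Y ⊆ Z)
    (hZ : Z ⊆ Γ.players) (h : Γ.u i (Y.erase i) < Γ.u i Y) : Γ.u i (Z.erase i) < Γ.u i Z := by
  rcases (Finset.erase_subset_erase i hYZ).eq_or_ssubset with he | hs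
  · have : Y = Z := by rw [← Finset.insert_erase hi, he, Finset.insert_erase (hYZ hi)]
    rwa [← this]
  · have := (hΓ.singleCrossing i (hZ (hYZ hi)) _ _ (Finset.erase_subset_erase i hZ) hs).2
    rw [Finset.insert_erase hi, Finset.insert_erase (hYZ hi)] at this
    exact this h

/-- If action `0` is optimal for `i` at `A` and action `1` is strictly optimal at a larger profile
`Z`, then `i` strictly prefers `Z`. -/
theorem lt_of_optimal (hΓ : Γ.IsRegular) {i : ι} {A Z : Finset ι} (hiA : i ∉ A) (hiZ : i ∈ Z)
    (hAZ : A ⊆ Z) (hZ : Z ⊆ Γ.players) (hA : Γ.u i (insert i A) ≤ Γ.u i A)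
    (h : Γ.u i (Z.erase i) < Γ.u i Z) : Γ.u i A < Γ.u i Z := by
  rcases (Finset.subset_erase.2 ⟨hAZ, hiA⟩).eq_or_ssubset with he | hs
  · rwa [he]
  · have hc := (hΓ.commonInterests i (hZ hiZ) _ _ (Finset.erase_subset_erase i hZ) hs).2
    simp only [bestPayoff, Finset.insert_erase hiZ, max_eq_left hA, max_eq_right h.le,
      true_imp_iff] at hc
    exact hc

/-- If action `1` is not strictly optimal for `i` at `Z`, then `i` weakly prefers to `Z` every
smaller profile without `i`. -/
theorem le_of_not_optimal (hΓ : Γ.IsRegular) {i : ι} {A Z : Finset ι} (hiA : i ∉ A) (hiZ : i ∈ Z)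
    (hAZ : A ⊆ Z) (hZ : Z ⊆ Γ.players) (h : Γ.u i Z ≤ Γ.u i (Z.erase i)) :
    Γ.u i Z ≤ Γ.u i A := by
  rcases (Finset.subset_erase.2 ⟨hAZ, hiA⟩).eq_or_ssubset with he | hs
  · rwa [he]
  · have hc := (hΓ.deviationProof i (hZ hiZ) _ _ (Finset.erase_subset_erase i hZ) hs).2
    rw [Finset.insert_erase hiZ] at hc
    exact le_of_not_gt fun hlt => (hc hlt).not_ge h

end IsRegular

namespace Forces

variable {T : ℕ} {C D Y : Finset ι}

/-- The players who join are strictly better off with action `1` at the profile that is reached. -/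
theorem erase_lt (hΓ : Γ.IsRegular) (h : Forces Γ.u T C Y) (hY : Y ⊆ Γ.players) :
    ∀ i ∈ Y, i ∉ C → Γ.u i (Y.erase i) < Γ.u i Y := by
  induction h with
  | refl => exact fun i hi hi' => absurd hi hi'
  | @lead T C Y j _ hu _ ih =>
    intro i hi hiC
    by_cases hij : i = j
    · rwa [hij]
    · exact ih hY i hi (by simp [hij, hiC])
  | @trans T C X Y h₁ h₂ ih₁ ih₂ =>
    intro i hi hiC
    by_cases hiX : i ∈ X
    · exact hΓ.lt_of_subset hiX h₂.subset hY (ih₁ (h₂.subset.trans hY) i hiX hiC)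
    · exact ih₂ hY i hi hiX

theorem union_right (hΓ : Γ.IsRegular) (h : Forces Γ.u T C Y) (hY : Y ⊆ Γ.players)
    (hD : D ⊆ Γ.players) : Forces Γ.u T (C ∪ D) (Y ∪ D) := by
  induction h with
  | refl => exact refl _ _
  | @lead T C Y i hi hu h ih =>
    have ih := ih hY
    rw [Finset.insert_union] at ih
    by_cases hiD : i ∈ D
    · rw [Finset.insert_eq_of_mem (Finset.mem_union_right _ hiD)] at ih
      exact ih.succ
    · exact lead (by simp [hi, hiD]) (hΓ.lt_of_subset (h.subset (Finset.mem_insert_self _ _))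
        Finset.subset_union_left (Finset.union_subset hY hD) hu) ih
  | trans _ h₂ ih₁ ih₂ => exact trans (ih₁ (h₂.subset.trans hY)) (ih₂ hY)

/-- Enlarging the set of committed players preserves that everybody is forced. -/
theorem players_of_subset (hΓ : Γ.IsRegular) (h : Forces Γ.u T C Γ.players) (hCD : C ⊆ D)
    (hD : D ⊆ Γ.players) : Forces Γ.u T D Γ.players := by
  have := h.union_right hΓ subset_rfl hD
  rwa [Finset.union_eq_right.2 hCD, Finset.union_eq_left.2 hD] at this

end Forces

/-! ### The largest forced set -/

open Classical in
/-- The players who belong to some set of players forced by `C` within `T` stages. -/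
noncomputable def forced (Γ : StageGame ι) (T : ℕ) (C : Finset ι) : Finset ι :=
  Γ.players.filter fun i => ∃ Y ⊆ Γ.players, Forces Γ.u T C Y ∧ i ∈ Y

section forced

variable {T T' : ℕ} {C D Y : Finset ι}

theorem mem_forced {i : ι} :
    i ∈ Γ.forced T C ↔ ∃ Y ⊆ Γ.players, Forces Γ.u T C Y ∧ i ∈ Y := by
  simp only [forced, Finset.mem_filter]
  exact and_iff_right_of_imp fun ⟨_, hY, _, hi⟩ => hY hi

theorem forced_subset_players : Γ.forced T C ⊆ Γ.players := fun _ hi =>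
  let ⟨_, hY, _, hi⟩ := mem_forced.1 hi
  hY hi

theorem Forces.subset_forced (h : Forces Γ.u T C Y) (hY : Y ⊆ Γ.players) : Y ⊆ Γ.forced T C :=
  fun _ hi => mem_forced.2 ⟨Y, hY, h, hi⟩

theorem subset_forced (hC : C ⊆ Γ.players) : C ⊆ Γ.forced T C := (Forces.refl T C).subset_forced hC

theorem forces_forced (hΓ : Γ.IsRegular) (hC : C ⊆ Γ.players) :
    Forces Γ.u T C (Γ.forced T C) := by
  classical
  obtain ⟨Y, hYmem, hmax⟩ :=
    (Γ.players.powerset.filter fun Y => Forces Γ.u T C Y).exists_max_image Finset.card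
      ⟨C, by simpa [hC] using Forces.refl T C⟩
  simp only [Finset.mem_filter, Finset.mem_powerset] at hYmem hmax
  suffices Γ.forced T C = Y by rw [this]; exact hYmem.2
  refine Finset.Subset.antisymm (fun i hi => ?_) (hYmem.2.subset_forced hYmem.1)
  obtain ⟨Z, hZ, hCZ, hiZ⟩ := mem_forced.1 hi
  have hZY : Forces Γ.u T C (Z ∪ Y) := by
    have := hCZ.union_right hΓ hZ hYmem.1
    rw [Finset.union_eq_right.2 hYmem.2.subset] at this
    exact hYmem.2.trans this
  have := Finset.eq_of_subset_of_card_le Finset.subset_union_right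
    (hmax _ ⟨Finset.union_subset hZ hYmem.1, hZY⟩)
  rw [this]
  exact Finset.mem_union_left _ hiZ

theorem forced_mono (hΓ : Γ.IsRegular) (hT : T ≤ T') (hCD : C ⊆ D) (hD : D ⊆ Γ.players) :
    Γ.forced T C ⊆ Γ.forced T' D := by
  have h := (forces_forced (T := T) hΓ (hCD.trans hD)).union_right hΓ forced_subset_players hD
  rw [Finset.union_eq_right.2 hCD] at h
  exact Finset.subset_union_left.trans ((h.mono hT).subset_forced
    (Finset.union_subset forced_subset_players hD))

theorem forced_forced (hΓ : Γ.IsRegular) (hT : T' ≤ T) (hC : C ⊆ Γ.players) :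
    Γ.forced T' (Γ.forced T C) = Γ.forced T C :=
  Finset.Subset.antisymm
    (((forces_forced hΓ hC).trans
      ((forces_forced hΓ forced_subset_players).mono hT)).subset_forced forced_subset_players)
    (subset_forced forced_subset_players)

theorem forced_zero (hΓ : Γ.IsRegular) (hC : C ⊆ Γ.players) : Γ.forced 0 C = C :=
  (forces_forced hΓ hC).eq_of_zero.symm

theorem forces_players_iff (hΓ : Γ.IsRegular) (hC : C ⊆ Γ.players) :
    Γ.players ⊆ Γ.forced T C ↔ Forces Γ.u T C Γ.players := by
  refine ⟨fun h => ?_, fun h => h.subset_forced subset_rfl⟩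
  have := forces_forced (T := T) hΓ hC
  rwa [forced_subset_players.antisymm h] at this

theorem forces_mem_SSS (hΓ : Γ.IsRegular) (h : Forces Γ.u T ∅ Y) (hY : Y ⊆ Γ.players)
    (hne : Y.Nonempty) : Y ∈ Γ.SSS :=
  ⟨hY, hne, fun i hi => h.erase_lt hΓ hY i hi (Finset.notMem_empty i)⟩

/-- A nonempty set which is forced by `∅` and forces nobody else is a strictly sufficient
equilibrium. -/
theorem forces_mem_SSE (hΓ : Γ.IsRegular) (h : Forces Γ.u T ∅ Y) (hY : Y ⊆ Γ.players)
    (hne : Y.Nonempty) (hmax : Γ.forced 1 Y ⊆ Y) : Y ∈ Γ.SSE := by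
  have hS := forces_mem_SSS hΓ h hY hne
  refine ⟨hS, hY, fun i hi => ?_⟩
  by_cases hiY : i ∈ Y
  · exact ⟨by rw [Finset.insert_eq_of_mem hiY], (hS.2.2 i hiY).le⟩
  · refine ⟨le_of_not_gt fun hlt => hiY ?_, by rw [Finset.erase_eq_of_notMem hiY]⟩
    exact hmax ((Forces.insert_of_lt le_rfl hiY hlt).subset_forced
      (Finset.insert_subset hi hY) (Finset.mem_insert_self _ _))

end forced

/-! ### Play of the synchronous game -/

section play

variable {T : ℕ} {s : ι → List (Finset ι) → Bool} {h : List (Finset ι)}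

theorem IsHistory.nil : Γ.IsHistory [] := by simp [IsHistory]

theorem IsHistory.headD_subset (hh : Γ.IsHistory h) : h.headD ∅ ⊆ Γ.players := by
  cases h with
  | nil => exact Finset.empty_subset _
  | cons a h => exact hh.1 a (List.mem_cons_self)

theorem IsHistory.cons (hh : Γ.IsHistory h) {E : Finset ι} (hE : E ⊆ Γ.players)
    (hC : h.headD ∅ ⊆ E) : Γ.IsHistory (E :: h) := by
  refine ⟨by simpa [hE] using hh.1, List.pairwise_cons.2 ⟨fun a ha => ?_, hh.2⟩⟩
  cases h with
  | nil => simp at ha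
  | cons b h =>
    rcases List.mem_cons.1 ha with rfl | ha
    · exact hC
    · exact ((List.pairwise_cons.1 hh.2).1 a ha).trans hC

theorem outcome_of_lt (hT : h.length < T) :
    Γ.outcome T s h = Γ.outcome T s (Γ.stageProfile s h :: h) := by
  obtain ⟨n, hn⟩ := Nat.exists_eq_add_of_lt hT
  have h₁ : T - h.length = n + 1 := by omega
  have h₂ : T - (Γ.stageProfile s h :: h).length = n := by simp; omega
  rw [outcome, outcome, h₁, h₂, play]

theorem outcome_of_length_eq (hT : h.length = T) : Γ.outcome T s h = h.headD ∅ := by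
  simp [outcome, hT, play]

/-- The outcome depends only on what is prescribed at histories at least as long as the present
one. -/
theorem outcome_congr {s' : ι → List (Finset ι) → Bool} :
    ∀ (n : ℕ) (h : List (Finset ι)), h.length + n = T →
      (∀ h', h.length ≤ h'.length → ∀ i, s i h' = s' i h') →
      Γ.outcome T s h = Γ.outcome T s' h := by
  intro n
  induction n with
  | zero =>
    intro h hT _
    rw [outcome_of_length_eq (by omega), outcome_of_length_eq (by omega)]
  | succ n ih =>
    intro h hT hs
    have hE : Γ.stageProfile s h = Γ.stageProfile s' h := by
      simp only [stageProfile, hs h le_rfl]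
    rw [outcome_of_lt (by omega), outcome_of_lt (s := s') (by omega), hE]
    refine ih _ (by simp; omega) fun h' hl => hs h' ?_
    simp at hl; omega

theorem headD_subset_stageProfile (hs : ∀ i ∈ Γ.players, Γ.IsStrategy T i (s i))
    (hh : Γ.IsHistory h) (hT : h.length < T) : h.headD ∅ ⊆ Γ.stageProfile s h :=
  fun i hi => Finset.mem_filter.2
    ⟨hh.headD_subset hi, hs i (hh.headD_subset hi) h hh hT hi⟩

theorem isHistory_stageProfile_cons (hs : ∀ i ∈ Γ.players, Γ.IsStrategy T i (s i))
    (hh : Γ.IsHistory h) (hT : h.length < T) : Γ.IsHistory (Γ.stageProfile s h :: h) :=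
  hh.cons (Finset.filter_subset _ _) (headD_subset_stageProfile hs hh hT)

theorem outcome_subset_players (hs : ∀ i ∈ Γ.players, Γ.IsStrategy T i (s i)) :
    ∀ (n : ℕ) (h : List (Finset ι)), Γ.IsHistory h → h.length + n = T →
      Γ.outcome T s h ⊆ Γ.players := by
  intro n
  induction n with
  | zero =>
    intro h hh hT
    rw [outcome_of_length_eq (by omega)]
    exact hh.headD_subset
  | succ n ih =>
    intro h hh hT
    rw [outcome_of_lt (by omega)]
    exact ih _ (isHistory_stageProfile_cons hs hh (by omega)) (by simp; omega)

theorem headD_subset_outcome (hs : ∀ i ∈ Γ.players, Γ.IsStrategy T i (s i)) :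
    ∀ (n : ℕ) (h : List (Finset ι)), Γ.IsHistory h → h.length + n = T →
      h.headD ∅ ⊆ Γ.outcome T s h := by
  intro n
  induction n with
  | zero =>
    intro h _ hT
    rw [outcome_of_length_eq (by omega)]
  | succ n ih =>
    intro h hh hT
    rw [outcome_of_lt (by omega)]
    exact (headD_subset_stageProfile hs hh (by omega)).trans
      (ih _ (isHistory_stageProfile_cons hs hh (by omega)) (by simp; omega))

/-- Under monotone strategies the outcome is monotone in the history. -/
theorem IsMonotone.outcome_subset (hm : Γ.IsMonotone T s)
    (hs : ∀ i ∈ Γ.players, Γ.IsStrategy T i (s i)) :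
    ∀ (n : ℕ) (h₁ h₂ : List (Finset ι)), Γ.IsHistory h₁ → Γ.IsHistory h₂ → h₁.length + n = T →
      List.Forall₂ (· ⊆ ·) h₂ h₁ → Γ.outcome T s h₂ ⊆ Γ.outcome T s h₁ := by
  intro n
  induction n with
  | zero =>
    intro h₁ h₂ _ _ hT hle
    have hl := hle.length_eq
    rw [outcome_of_length_eq (by omega), outcome_of_length_eq (by omega)]
    cases hle with
    | nil => exact subset_rfl
    | cons h _ => exact h
  | succ n ih =>
    intro h₁ h₂ hh₁ hh₂ hT hle
    have hl := hle.length_eq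
    rw [outcome_of_lt (by omega), outcome_of_lt (h := h₁) (by omega)]
    refine ih _ _ (isHistory_stageProfile_cons hs hh₁ (by omega))
      (isHistory_stageProfile_cons hs hh₂ (by omega)) (by simp; omega) (.cons ?_ hle)
    intro i hi
    obtain ⟨hiN, hi⟩ := Finset.mem_filter.1 hi
    exact Finset.mem_filter.2 ⟨hiN, hm i hiN h₁ h₂ hh₁ hh₂ (by omega) hle hi⟩

/-- Deviating to `1` at `h` only: play continues as if `i` had joined the others at `h`. -/
theorem outcome_update_true {i : ι} (hi : i ∈ Γ.players) (hT : h.length < T) :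
    Γ.outcome T (Function.update s i (Function.update (s i) h true)) h =
      Γ.outcome T s (insert i (Γ.stageProfile s h) :: h) := by
  have hE : Γ.stageProfile (Function.update s i (Function.update (s i) h true)) h =
      insert i (Γ.stageProfile s h) := by
    ext j
    by_cases hj : j = i
    · subst hj; simp [stageProfile, hi]
    · simp [stageProfile, hj]
  rw [outcome_of_lt hT, hE]
  refine outcome_congr (T - (h.length + 1)) _ (by simp; omega) fun h' hl j => ?_
  by_cases hj : j = i
  · subst hj
    have : h' ≠ h := by rintro rfl; simp at hl
    simp [this]
  · rw [Function.update_of_ne hj]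

/-- Nobody gains in equilibrium by joining earlier than prescribed. -/
theorem IsSPNE.outcome_insert_le (hs : Γ.IsSPNE T s) (hh : Γ.IsHistory h) (hT : h.length < T)
    {i : ι} (hi : i ∈ Γ.players) :
    Γ.u i (Γ.outcome T s (insert i (Γ.stageProfile s h) :: h)) ≤ Γ.u i (Γ.outcome T s h) := by
  rw [← outcome_update_true hi hT]
  refine hs.2 h hh hT i hi _ fun h' hh' hT' hi' => ?_
  by_cases he : h' = h
  · subst he; simp
  · rw [Function.update_of_ne he]
    exact hs.1 i hi h' hh' hT' hi'

/-- At the last stage a player who ends up with action `0` could still switch, so `0` is optimal at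
the outcome. -/
theorem IsSPNE.insert_outcome_le (hs : Γ.IsSPNE T s) {i : ι} (hi : i ∈ Γ.players) :
    ∀ (n : ℕ) (h : List (Finset ι)), Γ.IsHistory h → h.length + (n + 1) = T →
      Γ.u i (insert i (Γ.outcome T s h)) ≤ Γ.u i (Γ.outcome T s h) := by
  intro n
  induction n with
  | zero =>
    intro h hh hT
    have h₁ := hs.outcome_insert_le hh (by omega) hi
    rw [outcome_of_length_eq (by simp; omega)] at h₁
    have h₂ : Γ.outcome T s h = Γ.stageProfile s h := by
      rw [outcome_of_lt (by omega), outcome_of_length_eq (by simp; omega)]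
      rfl
    rw [h₂] at h₁ ⊢
    exact h₁
  | succ n ih =>
    intro h hh hT
    rw [outcome_of_lt (by omega)]
    exact ih _ (isHistory_stageProfile_cons hs.1 hh (by omega)) (by simp; omega)

end play

/-! ### Equilibrium outcomes contain the forced set -/

/-- In a monotone equilibrium, if `C` forces `Y` within the remaining stages and the outcome
contains `C`, then it contains `Y`, even when the players in `C` have yet to choose `1`. -/
theorem Forces.subset_outcome (hΓ : Γ.IsRegular) {T : ℕ} {s : ι → List (Finset ι) → Bool}
    (hs : Γ.IsSPNE T s) (hm : Γ.IsMonotone T s) {n : ℕ} {C Y : Finset ι} (hF : Forces Γ.u n C Y)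
    (hY : Y ⊆ Γ.players) :
    ∀ h, Γ.IsHistory h → h.length + n = T → C ⊆ Γ.outcome T s h → Y ⊆ Γ.outcome T s h := by
  induction hF with
  | refl => exact fun _ _ _ h => h
  | trans _ h₂ ih₁ ih₂ =>
    exact fun h hh hT hC => ih₂ hY h hh hT (ih₁ (h₂.subset.trans hY) h hh hT hC)
  | @lead n C Y i _ hu hF ih =>
    intro h hh hT hC
    have hiY : i ∈ Y := hF.subset (Finset.mem_insert_self _ _)
    have hiN : i ∈ Γ.players := hY hiY
    have hlt : h.length < T := by omega
    have hE := isHistory_stageProfile_cons hs.1 hh hlt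
    by_cases hiO : i ∈ Γ.outcome T s h
    · have hnext := outcome_of_lt (Γ := Γ) (s := s) hlt
      rw [hnext] at hiO hC ⊢
      exact ih hY _ hE (by simp; omega) (Finset.insert_subset hiO hC)
    -- Otherwise `i` would gain by taking the lead at `h`.
    exfalso
    have hE' : Γ.IsHistory (insert i (Γ.stageProfile s h) :: h) :=
      hh.cons (Finset.insert_subset hiN (Finset.filter_subset _ _))
        ((headD_subset_stageProfile hs.1 hh hlt).trans (Finset.subset_insert _ _))
    have hlen : (insert i (Γ.stageProfile s h) :: h).length + n = T := by simp; omega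
    have hOO' : Γ.outcome T s h ⊆ Γ.outcome T s (insert i (Γ.stageProfile s h) :: h) := by
      rw [outcome_of_lt hlt]
      exact hm.outcome_subset hs.1 n _ _ hE' hE hlen
        (.cons (Finset.subset_insert _ _) (List.forall₂_refl h))
    have hiO' : i ∈ Γ.outcome T s (insert i (Γ.stageProfile s h) :: h) :=
      headD_subset_outcome hs.1 n _ hE' hlen (Finset.mem_insert_self _ _)
    have hYO' := ih hY _ hE' hlen (Finset.insert_subset hiO' (hC.trans hOO'))
    have hO'N := outcome_subset_players hs.1 n _ hE' hlen
    exact (hs.outcome_insert_le hh hlt hiN).not_gt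
      (hΓ.lt_of_optimal hiO hiO' hOO' hO'N (hs.insert_outcome_le hiN n h hh hT)
        (hΓ.lt_of_subset hiY hYO' hO'N hu))

/-! ### An equilibrium whose outcome is the forced set -/

/-- Play `1` if and only if you belong to the largest set that is forced, within the remaining
stages, by the players who have already chosen `1`. -/
noncomputable def forcedStrategy (Γ : StageGame ι) (T : ℕ) (i : ι) (h : List (Finset ι)) : Bool :=
  decide (i ∈ Γ.forced (T - h.length) (h.headD ∅))

section forcedStrategy

variable {T : ℕ}

theorem stageProfile_forcedStrategy (h : List (Finset ι)) :
    Γ.stageProfile (Γ.forcedStrategy T) h = Γ.forced (T - h.length) (h.headD ∅) := by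
  ext i
  simpa [stageProfile, forcedStrategy] using fun hi => forced_subset_players hi

theorem isStrategy_forcedStrategy (i : ι) : Γ.IsStrategy T i (Γ.forcedStrategy T i) :=
  fun _ hh _ hi => decide_eq_true (subset_forced hh.headD_subset hi)

theorem isMonotone_forcedStrategy (hΓ : Γ.IsRegular) : Γ.IsMonotone T (Γ.forcedStrategy T) := by
  intro i _ h₁ h₂ hh₁ _ _ hle
  have hhead : h₂.headD ∅ ⊆ h₁.headD ∅ := by
    cases hle with
    | nil => exact subset_rfl
    | cons h _ => exact h
  intro hi
  refine decide_eq_true (forced_mono hΓ ?_ hhead hh₁.headD_subset (of_decide_eq_true hi))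
  rw [hle.length_eq]

theorem outcome_forcedStrategy (hΓ : Γ.IsRegular) :
    ∀ (n : ℕ) (h : List (Finset ι)), Γ.IsHistory h → h.length + n = T →
      Γ.outcome T (Γ.forcedStrategy T) h = Γ.forced n (h.headD ∅) := by
  intro n
  induction n with
  | zero =>
    intro h hh hT
    rw [outcome_of_length_eq (by omega), forced_zero hΓ hh.headD_subset]
  | succ n ih =>
    intro h hh hT
    rw [outcome_of_lt (by omega), ih _ (isHistory_stageProfile_cons
      (fun i _ => isStrategy_forcedStrategy i) hh (by omega)) (by simp; omega),
      stageProfile_forcedStrategy, show T - h.length = n + 1 by omega]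
    exact forced_forced hΓ (by omega) hh.headD_subset

/-- No deviation of `i` yields more than the forced set. By induction on the number of remaining
stages it suffices to compare the sets forced by the profiles that `i` can produce at the first
stage. -/
theorem outcome_update_forcedStrategy_le (hΓ : Γ.IsRegular) {i : ι} (hi : i ∈ Γ.players)
    {σ : List (Finset ι) → Bool} (hσ : Γ.IsStrategy T i σ) :
    ∀ (n : ℕ) (h : List (Finset ι)), Γ.IsHistory h → h.length + n = T →
      Γ.u i (Γ.outcome T (Function.update (Γ.forcedStrategy T) i σ) h) ≤
        Γ.u i (Γ.forced n (h.headD ∅)) := by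
  have hs : ∀ j ∈ Γ.players, Γ.IsStrategy T j (Function.update (Γ.forcedStrategy T) i σ j) := by
    intro j _
    by_cases hj : j = i
    · subst hj; simpa using hσ
    · rw [Function.update_of_ne hj]; exact isStrategy_forcedStrategy j
  intro n
  induction n with
  | zero =>
    intro h hh hT
    rw [outcome_of_length_eq (by omega), forced_zero hΓ hh.headD_subset]
  | succ n ih =>
    intro h hh hT
    have hE := isHistory_stageProfile_cons hs hh (by omega)
    have hstep := ih _ hE (by simp; omega)
    rw [← outcome_of_lt (by omega)] at hstep
    refine hstep.trans ?_
    have hC := hh.headD_subset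
    have hCE := headD_subset_stageProfile hs hh (by omega)
    set E := Γ.stageProfile (Function.update (Γ.forcedStrategy T) i σ) h with hEdef
    set C := h.headD ∅ with hCdef
    change Γ.u i (Γ.forced n E) ≤ _
    have hmem : ∀ j, j ≠ i → (j ∈ E ↔ j ∈ Γ.forced (n + 1) C) := by
      intro j hj
      have hn : T - h.length = n + 1 := by omega
      simp only [hEdef, stageProfile, Function.update_of_ne hj, forcedStrategy, hn,
        Finset.mem_filter, decide_eq_true_eq, ← hCdef]
      exact ⟨fun h => h.2, fun h => ⟨forced_subset_players h, h⟩⟩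
    have hEN : E ⊆ Γ.players := Finset.filter_subset _ _
    have hFF : Forces Γ.u (n + 1) C (Γ.forced (n + 1) C) := forces_forced hΓ hC
    by_cases hiE : i ∈ E <;> by_cases hiG : i ∈ Γ.forced (n + 1) C
    · have : E = Γ.forced (n + 1) C := by
        ext j
        by_cases hj : j = i
        · simp [hj, hiE, hiG]
        · exact hmem j hj
      rw [this, forced_forced hΓ (by omega) hC]
    · -- `i` takes the lead. If `1` were strictly optimal afterwards, `i` would be forced.
      have hEq : E = insert i (Γ.forced (n + 1) C) := by
        ext j
        by_cases hj : j = i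
        · simp [hj, hiE]
        · simpa [hj] using hmem j hj
      have hEF : E ⊆ Γ.forced n E := subset_forced hEN
      refine hΓ.le_of_not_optimal hiG (hEF hiE)
        (((Finset.subset_insert i _).trans hEq.symm.subset).trans hEF) forced_subset_players
        (le_of_not_gt fun hlt => hiG ?_)
      have hlead : Forces Γ.u (n + 1) (Γ.forced (n + 1) C) (Γ.forced n E) :=
        .lead hiG hlt (hEq ▸ forces_forced hΓ hEN)
      exact (hFF.trans hlead).subset_forced forced_subset_players (hEF hiE)
    · -- `i` does not join although forced: the outcome then loses at most `i`.
      have hEq : E = (Γ.forced (n + 1) C).erase i := by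
        ext j
        by_cases hj : j = i
        · simp [hj, hiE]
        · simpa [hj] using hmem j hj
      have hle : Γ.forced n E ⊆ Γ.forced (n + 1) C := by
        rw [← forced_forced hΓ (Nat.le_succ n) hC]
        exact forced_mono hΓ le_rfl (hEq ▸ Finset.erase_subset _ _) forced_subset_players
      have hge : E ⊆ Γ.forced n E := subset_forced hEN
      by_cases hi' : i ∈ Γ.forced n E
      · have : Γ.forced n E = Γ.forced (n + 1) C := by
          refine hle.antisymm fun j hj => ?_
          by_cases hji : j = i
          · rwa [hji]
          · exact hge ((hmem j hji).2 hj)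
        rw [this]
      · have : Γ.forced n E = (Γ.forced (n + 1) C).erase i :=
          Finset.Subset.antisymm (Finset.subset_erase.2 ⟨hle, hi'⟩) (hEq ▸ hge)
        rw [this]
        exact (hFF.erase_lt hΓ forced_subset_players i hiG fun h => hiE (hCE h)).le
    · have : E = Γ.forced (n + 1) C := by
        ext j
        by_cases hj : j = i
        · simp [hj, hiE, hiG]
        · exact hmem j hj
      rw [this, forced_forced hΓ (by omega) hC]

theorem isSPNE_forcedStrategy (hΓ : Γ.IsRegular) : Γ.IsSPNE T (Γ.forcedStrategy T) := by
  refine ⟨fun i _ => isStrategy_forcedStrategy i, fun h hh hT i hi σ hσ => ?_⟩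
  rw [outcome_forcedStrategy hΓ (T - h.length) h hh (by omega)]
  exact outcome_update_forcedStrategy_le hΓ hi hσ (T - h.length) h hh (by omega)

end forcedStrategy

/-! ### The number of stages needed -/

section tau

variable {T : ℕ} {X Y : Finset ι}

theorem isLeast_mspneOutcomes (hΓ : Γ.IsRegular) :
    IsLeast (Γ.mspneOutcomes T) (Γ.forced T ∅) := by
  refine ⟨⟨_, isSPNE_forcedStrategy hΓ, isMonotone_forcedStrategy hΓ,
    (outcome_forcedStrategy hΓ T [] IsHistory.nil (by simp)).symm⟩, ?_⟩
  rintro _ ⟨s, hs, hm, rfl⟩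
  exact (forces_forced hΓ (Finset.empty_subset _)).subset_outcome hΓ hs hm forced_subset_players
    [] IsHistory.nil (by simp) (Finset.empty_subset _)

theorem biInf_le_natCast_iff {α : Type*} {p : α → Prop} {f : α → ℕ∞} :
    ⨅ (a) (_ : p a), f a ≤ (T : ℕ∞) ↔ ∃ a, p a ∧ f a ≤ T := by
  simp only [← ENat.lt_add_one_iff (ENat.natCast_ne_top T), iInf_lt_iff, exists_prop]

theorem tauOf_le_iff (hΓ : Γ.IsRegular) :
    Γ.tauOf X ≤ T ↔ 1 ≤ T ∧ X ⊆ Γ.forced T ∅ := by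
  rw [tauOf, biInf_le_natCast_iff]
  constructor
  · rintro ⟨T', ⟨h1, hT'⟩, hle⟩
    have hle : T' ≤ T := by exact_mod_cast hle
    exact ⟨h1.trans hle, (hT' _ (isLeast_mspneOutcomes hΓ).1).trans
      (forced_mono hΓ hle subset_rfl (Finset.empty_subset _))⟩
  · rintro ⟨h1, hX⟩
    exact ⟨T, ⟨h1, fun Y hY => hX.trans ((isLeast_mspneOutcomes hΓ).2 hY)⟩, le_rfl⟩

theorem tau_le_iff (hΓ : Γ.IsRegular) :
    Γ.tau ≤ T ↔ 1 ≤ T ∧ Forces Γ.u T ∅ Γ.players := by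
  rw [tau, tauOf_le_iff hΓ, forces_players_iff hΓ (Finset.empty_subset _)]

theorem tau_lower_le_iff (hΓ : Γ.IsRegular) (hX : X ⊆ Γ.players) :
    (Γ.lower X).tau ≤ T ↔ 1 ≤ T ∧ Forces Γ.u T ∅ X :=
  tau_le_iff (hΓ.lower hX)

theorem tau_upper_sdiff_le_iff (hΓ : Γ.IsRegular) (hX : X ⊆ Γ.players) :
    (Γ.upper (Γ.players \ X)).tau ≤ T ↔ 1 ≤ T ∧ Forces Γ.u T X Γ.players := by
  rw [tau_le_iff (hΓ.upper Finset.sdiff_subset)]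
  have hu : (Γ.upper (Γ.players \ X)).u = fun i Z => Γ.u i (Z ∪ X) := by
    simp [StageGame.upper, Finset.inter_eq_right.2 hX]
  have hp : (Γ.upper (Γ.players \ X)).players = Γ.players \ X := rfl
  rw [hu, hp]
  refine and_congr_right fun _ => ⟨fun h => ?_, fun h => ?_⟩
  · simpa [Finset.sdiff_union_of_subset hX] using h.of_committed Finset.sdiff_disjoint
  · simpa using h.to_committed subset_rfl

theorem tau_upper_erase_le_iff (hΓ : Γ.IsRegular) {i : ι} (hi : i ∈ Γ.players) :
    (Γ.upper (Γ.players.erase i)).tau ≤ T ↔ 1 ≤ T ∧ Forces Γ.u T {i} Γ.players := by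
  rw [Finset.erase_eq, tau_upper_sdiff_le_iff hΓ (Finset.singleton_subset_iff.2 hi)]

theorem le_of_forall_natCast_le {a b : ℕ∞} (h : ∀ n : ℕ, b ≤ n → a ≤ n) : a ≤ b := by
  cases b with
  | top => exact le_top
  | coe n => exact h n le_rfl

theorem eq_of_forall_natCast_le_iff {a b : ℕ∞} (h : ∀ n : ℕ, a ≤ n ↔ b ≤ n) : a = b :=
  le_antisymm (le_of_forall_natCast_le fun n => (h n).2) (le_of_forall_natCast_le fun n => (h n).1)

theorem tauOf_ne_top (hΓ : Γ.IsRegular)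
    (hN : ∀ i ∈ Γ.players, Γ.u i (Γ.players.erase i) < Γ.u i Γ.players) (hX : X ⊆ Γ.players) :
    Γ.tauOf X ≠ ⊤ := by
  refine ne_top_of_le_ne_top (ENat.natCast_ne_top (Γ.players.card + 1))
    ((tauOf_le_iff hΓ).2 ⟨by omega, hX.trans ?_⟩)
  exact (Forces.of_forall_lt _ _ _ (Finset.empty_subset _) (by simp) hN).subset_forced subset_rfl

theorem tauOf_empty (hΓ : Γ.IsRegular) : Γ.tauOf ∅ = 1 :=
  eq_of_forall_natCast_le_iff fun n => by
    rw [tauOf_le_iff hΓ]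
    simp

/-- If it is finite, `τ_Γ(X)` is attained at the least equilibrium outcome of
the game with `τ_Γ(X)` stages, which is a strictly sufficient equilibrium. -/
theorem isLeast_tauOf (hΓ : Γ.IsRegular) {S : Set (Finset ι)} (hSSE : Γ.SSE ⊆ S) (hSSS : S ⊆ Γ.SSS)
    (hne : X.Nonempty) (htop : Γ.tauOf X ≠ ⊤) :
    IsLeast {n : ℕ∞ | ∃ Y ∈ S, X ⊆ Y ∧ n = (Γ.lower Y).tau} (Γ.tauOf X) := by
  have hlb : ∀ Y ∈ Γ.SSS, X ⊆ Y → Γ.tauOf X ≤ (Γ.lower Y).tau := by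
    intro Y hY hXY
    refine le_of_forall_natCast_le fun T hT => ?_
    obtain ⟨h1, hF⟩ := (tau_lower_le_iff hΓ hY.1).1 hT
    exact (tauOf_le_iff hΓ).2 ⟨h1, hXY.trans (hF.subset_forced hY.1)⟩
  obtain ⟨T, hT⟩ := ENat.ne_top_iff_exists.1 htop
  obtain ⟨h1, hX⟩ := (tauOf_le_iff hΓ).1 hT.ge
  have hF : Forces Γ.u T ∅ (Γ.forced T ∅) := forces_forced hΓ (Finset.empty_subset _)
  have hE : Γ.forced T ∅ ∈ Γ.SSE := forces_mem_SSE hΓ hF forced_subset_players (hne.mono hX)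
    (forced_forced hΓ h1 (Finset.empty_subset _)).subset
  refine ⟨⟨_, hSSE hE, hX, (hlb _ hE.1 hX).antisymm ?_⟩, ?_⟩
  · rw [← hT]
    exact (tau_lower_le_iff hΓ forced_subset_players).2 ⟨h1, hF⟩
  · rintro _ ⟨Y, hY, hXY, rfl⟩
    exact hlb Y (hSSS hY) hXY

theorem tau_eq_tau_upper_erase (hΓ : Γ.IsRegular) {i : ι} (hi : i ∈ Γ.players)
    (hu : Γ.u i ∅ < Γ.u i {i}) : Γ.tau = (Γ.upper (Γ.players.erase i)).tau :=
  eq_of_forall_natCast_le_iff fun T => by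
    rw [tau_le_iff hΓ, tau_upper_erase_le_iff hΓ hi]
    refine and_congr_right fun hT => ⟨fun h => ?_, fun h => ?_⟩
    · exact h.players_of_subset hΓ (Finset.empty_subset _) (Finset.singleton_subset_iff.2 hi)
    · exact (Forces.insert_of_lt hT (Finset.notMem_empty i) hu).trans h

/-- When no player has `1` as a dominant action, everybody is forced by `∅` only through a leader or
along a proper strictly sufficient equilibrium. -/
theorem forces_players_cases (hΓ : Γ.IsRegular)
    (hne : Γ.players.Nonempty) (hdom : ∀ i ∈ Γ.players, Γ.u i {i} ≤ Γ.u i ∅)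
    (h : Forces Γ.u T ∅ Γ.players) :
    (∃ i ∈ Γ.players, ∃ T', 1 ≤ T' ∧ T = T' + 1 ∧ Forces Γ.u T' {i} Γ.players) ∨
      ∃ X ∈ Γ.SSE, X ≠ Γ.players ∧ Forces Γ.u T ∅ X ∧ Forces Γ.u T X Γ.players := by
  classical
  -- Without a dominant action a leader needs at least one stage after the first.
  have hpos : ∀ {i T' Y}, Y ⊆ Γ.players → Y.Nonempty → Forces Γ.u T ∅ Y →
      Forces Γ.u T' {i} Y → 1 ≤ T' := by
    intro i T' Y hY hYne hF hl
    rcases Nat.eq_zero_or_pos T' with rfl | hp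
    · obtain rfl := hl.eq_of_zero
      have hi : i ∈ ({i} : Finset ι) := Finset.mem_singleton_self i
      have := hF.erase_lt hΓ hY i hi (Finset.notMem_empty i)
      rw [Finset.erase_singleton] at this
      exact absurd this (hdom i (hY hi)).not_gt
    · exact hp
  rcases h.lead_or_split hne.ne_empty.symm with ⟨i, T', _, hT, hl⟩ | ⟨X₀, hX₀, hX₀N, h₁, h₂⟩
  · exact Or.inl ⟨i, hl.subset (Finset.mem_insert_self _ _), T',
      hpos subset_rfl hne h hl, hT, hl⟩
  obtain ⟨X, hXmem, hmin⟩ := (Γ.players.powerset.filter fun X =>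
      X ≠ ∅ ∧ X ≠ Γ.players ∧ Forces Γ.u T ∅ X).exists_min_image Finset.card
    ⟨X₀, by simp [hX₀, hX₀N, h₁, h₂.subset]⟩
  simp only [Finset.mem_filter, Finset.mem_powerset] at hXmem hmin
  obtain ⟨hXN, hXe, hXne, hX⟩ := hXmem
  have hXne' := Finset.nonempty_iff_ne_empty.2 hXe
  rcases hX.lead_or_split hXe.symm with ⟨i, T', _, hT, hl⟩ | ⟨Z, hZe, hZX, hZ₁, hZ₂⟩
  · have hT' := hpos hXN hXne' hX hl
    have hF : Forces Γ.u 1 X (Γ.forced 1 X) := forces_forced hΓ hXN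
    by_cases hE : Γ.forced 1 X = Γ.players
    · rw [hE] at hF
      exact Or.inl ⟨i, hXN (hl.subset (Finset.mem_insert_self _ _)), T', hT', hT,
        hl.trans (hF.mono hT')⟩
    · have hFT : Forces Γ.u T ∅ (Γ.forced 1 X) := hX.trans (hF.mono (by omega))
      exact Or.inr ⟨_, forces_mem_SSE hΓ hFT forced_subset_players (hXne'.mono hF.subset)
        (forced_forced hΓ le_rfl hXN).subset, hE, hFT,
        h.players_of_subset hΓ (Finset.empty_subset _) forced_subset_players⟩
  · have hlt := Finset.card_lt_card (hZ₂.subset.ssubset_of_ne hZX)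
    exact absurd (hmin Z ⟨hZ₂.subset.trans hXN, hZe,
      fun h => hZX (hZ₂.subset.antisymm (h ▸ hXN)), hZ₁⟩) hlt.not_ge

theorem tau_eq_recursionValue (hΓ : Γ.IsRegular)
    (hN : ∀ i ∈ Γ.players, Γ.u i (Γ.players.erase i) < Γ.u i Γ.players)
    (hne : Γ.players.Nonempty) (hdom : ∀ i ∈ Γ.players, Γ.u i {i} ≤ Γ.u i ∅)
    {S : Set (Finset ι)} (hSSE : Γ.SSE ⊆ S) (hSSS : S ⊆ Γ.SSS) :
    Γ.tau = Γ.recursionValue S := by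
  refine eq_of_forall_natCast_le_iff fun T => ?_
  have hlead : 1 + ⨅ i ∈ Γ.players, (Γ.upper (Γ.players.erase i)).tau ≤ T ↔
      ∃ i ∈ Γ.players, ∃ T', 1 ≤ T' ∧ T = T' + 1 ∧ Forces Γ.u T' {i} Γ.players := by
    cases T with
    | zero => simp
    | succ T =>
      rw [add_comm, Nat.cast_succ, ENat.add_le_add_iff_right ENat.one_ne_top,
        biInf_le_natCast_iff]
      refine exists_congr fun i => and_congr_right fun hi => ?_
      rw [tau_upper_erase_le_iff hΓ hi]
      simp
  have hsplit : (⨅ X ∈ S \ {∅, Γ.players}, max (Γ.lower X).tau (Γ.upper (Γ.players \ X)).tau) ≤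
      (T : ℕ∞) ↔ ∃ X ∈ S, X ≠ Γ.players ∧ 1 ≤ T ∧ Forces Γ.u T ∅ X ∧ Forces Γ.u T X Γ.players := by
    rw [biInf_le_natCast_iff]
    refine exists_congr fun X => ?_
    constructor
    · rintro ⟨⟨hX, hX'⟩, hle⟩
      have hXN := (hSSS hX).1
      rw [max_le_iff, tau_lower_le_iff hΓ hXN, tau_upper_sdiff_le_iff hΓ hXN] at hle
      exact ⟨hX, fun h => hX' (by simp [h]), hle.1.1, hle.1.2, hle.2.2⟩
    · rintro ⟨hX, hXne, h1, h₁, h₂⟩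
      have hXN := (hSSS hX).1
      rw [max_le_iff, tau_lower_le_iff hΓ hXN, tau_upper_sdiff_le_iff hΓ hXN]
      exact ⟨⟨hX, by simp [hXne, (hSSS hX).2.1.ne_empty]⟩, ⟨h1, h₁⟩, h1, h₂⟩
  rw [recursionValue, min_le_iff, hlead, hsplit, tau_le_iff hΓ]
  constructor
  · rintro ⟨h1, h⟩
    rcases forces_players_cases hΓ hne hdom h with h | ⟨X, hX, hXne, h₁, h₂⟩
    · exact Or.inl h
    · exact Or.inr ⟨X, hSSE hX, hXne, h1, h₁, h₂⟩
  · rintro (⟨i, hi, T', _, rfl, h⟩ | ⟨X, _, _, h1, h₁, h₂⟩)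
    · exact ⟨by omega, .lead (Finset.notMem_empty i) (hN i hi) h⟩
    · exact ⟨h1, h₁.trans h₂⟩

end tau

end StageGame

theorem mainTheorem2 {ι : Type*} [DecidableEq ι] (Γ : StageGame ι)
    (hSC : Γ.SingleCrossing) (hCI : Γ.CommonInterests) (hDP : Γ.DeviationProof)
    (hN : ∀ i ∈ Γ.players, Γ.u i (Γ.players.erase i) < Γ.u i Γ.players) :
    (∀ X ⊆ Γ.players, Γ.tauOf X ≠ ⊤) ∧
    Γ.tauOf ∅ = 1 ∧
    (∀ S : Set (Finset ι), S = Γ.SSS ∨ S = Γ.SSE →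
      (∀ X ⊆ Γ.players, X.Nonempty →
        IsLeast {n : ℕ∞ | ∃ Y ∈ S, X ⊆ Y ∧ n = (Γ.lower Y).tau} (Γ.tauOf X)) ∧
      (∀ i ∈ Γ.players, Γ.u i ∅ < Γ.u i {i} →
        Γ.tau = (Γ.upper (Γ.players.erase i)).tau) ∧
      (Γ.players = ∅ → Γ.tau = 1) ∧
      (Γ.players.Nonempty → (∀ i ∈ Γ.players, Γ.u i {i} ≤ Γ.u i ∅) →
        Γ.tau = Γ.recursionValue S)) := by
  have hΓ : Γ.IsRegular := ⟨hSC, hCI, hDP⟩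
  refine ⟨fun X hX => StageGame.tauOf_ne_top hΓ hN hX, StageGame.tauOf_empty hΓ, fun S hS => ?_⟩
  have hSub : Γ.SSE ⊆ Γ.SSS := fun X hX => hX.1
  obtain ⟨hSSE, hSSS⟩ : Γ.SSE ⊆ S ∧ S ⊆ Γ.SSS := by
    rcases hS with rfl | rfl
    · exact ⟨hSub, subset_rfl⟩
    · exact ⟨subset_rfl, hSub⟩
  refine ⟨fun X hX hne => StageGame.isLeast_tauOf hΓ hSSE hSSS hne
      (StageGame.tauOf_ne_top hΓ hN hX),
    fun i hi hu => StageGame.tau_eq_tau_upper_erase hΓ hi hu, fun h => ?_,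
    fun hne hdom => StageGame.tau_eq_recursionValue hΓ hN hne hdom hSSE hSSS⟩
  rw [StageGame.tau, h, StageGame.tauOf_empty hΓ]
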